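/- Let $\mathcal A\subset\mathbb N^4$ be the finite minimal generating set of an affine semigroup (submonoid) $\mathcal S=\langle\mathcal A\rangle\subseteq\mathbb N^4$ whose group $\mathbb Z\mathcal A$ has rank $4$. Suppose that $\mathcal S$ is simplicial and that $E\subseteq\mathcal A$ is the set of its four extremal generators: $E$ has four elements, is linearly independent over $\mathbb Q$, generates the same cone of non-negative rational combinations as $\mathcal A$, and each $\mathbf a\in E$ is the componentwise smallest element of $\mathcal A$ on the ray $\mathbb Q_{\ge 0}\mathbf a$. For $\mathbf a,\mathbf a'\in\mathcal S$ write $\mathbf a\preceq_{\mathcal S}\mathbf a'$ if $\mathbf a'-\mathbf a\in\mathcal S$. For $E'\subseteq E$ let $$\operatorname{Ap}(\mathcal S,E')=\{\mathbf a\in\mathcal S\mid \mathbf a-\mathbf b\notin\mathcal S\text{ for all }\mathbf b\in E'\}.$$ For $\mathbf b\in\mathcal S$ let $T_{\mathbf b}$ be the simplicial complex $$T_{\mathbf b}=\Bigl\{F\subseteq E\;\Big|\;\mathbf b-\sum_{\mathbf a\in F}\mathbf a\in\mathcal S\Bigr\},$$ whose vertices are the $\mathbf a\in E$ with $\mathbf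 b-\mathbf a\in\mathcal S$; a vertex is isolated if it belongs to no face with more than one element. Let $\Bbbk$ be a field and let the depth of the semigroup ring $\Bbbk[\mathcal S]$ be the maximum length of a regular sequence on $\Bbbk[\mathcal S]$ contained in the ideal generated by the monomials $\mathbf t^{\mathbf a}$, $\mathbf 0\neq\mathbf a\in\mathcal S$. Suppose that $\operatorname{depth}\Bbbk[\mathcal S]=3$. Then $\operatorname{Ap}(\mathcal S,E')$ has a maximal element with respect to $\preceq_{\mathcal S}$ for some $E'\subset E$ of cardinality three if and only if there exists $\mathbf b\in\mathcal S$ such that $T_{\mathbf b}$ is not connected and has at least one isolated vertex. -/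

import Mathlib

noncomputable section

namespace SimplicialSemigroup

/-- A vector of `ℕ^d` viewed in `ℚ^d`. -/
def toRat {d : ℕ} (a : Fin d → ℕ) : Fin d → ℚ := fun i => (a i : ℚ)

/-- A vector of `ℕ^d` viewed in `ℤ^d`. -/
def toInt {d : ℕ} (a : Fin d → ℕ) : Fin d → ℤ := fun i => (a i : ℤ)

/-- The rational cone `pos(B)` of all non-negative rational combinations of elements of `B`. -/
def pos {d : ℕ} (B : Finset (Fin d → ℕ)) : Set (Fin d → ℚ) :=
  {v | ∃ q : (Fin d → ℕ) → ℚ, (∀ a ∈ B, 0 ≤ q a) ∧ v = ∑ a ∈ B, q a • toRat a}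

/-- The affine semigroup (a submonoid of `ℕ^d`) generated by `A`. -/
def semigroup {d : ℕ} (A : Finset (Fin d → ℕ)) : AddSubmonoid (Fin d → ℕ) :=
  AddSubmonoid.closure (A : Set (Fin d → ℕ))

/-- The standing setting: the affine semigroup generated by `A ⊆ ℕ^d` is simplicial, `A` is its
minimal generating set, and `E ⊆ A` consists of the smallest elements of `A` on the `d` extremal
rays of the cone `pos(A)`. -/
structure IsSimplicial {d : ℕ} (A E : Finset (Fin d → ℕ)) : Prop where
  /-- no proper subset of `A` generates the same semigroup -/
  minimal : ∀ B : Finset (Fin d → ℕ), B ⊂ A → semigroup B ≠ semigroup A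
  /-- the group `ℤA` has rank `d` -/
  rank_eq : Module.finrank ℤ (Submodule.span ℤ (toInt '' (A : Set (Fin d → ℕ)))) = d
  subset : E ⊆ A
  card_eq : E.card = d
  linearIndep : LinearIndepOn ℚ toRat (E : Set (Fin d → ℕ))
  pos_eq : pos E = pos A
  /-- each `a ∈ E` is the componentwise smallest element of `A` on the ray through `a` -/
  smallest : ∀ a ∈ E, ∀ a' ∈ A, (∃ q : ℚ, 0 ≤ q ∧ toRat a' = q • toRat a) → a ≤ a'

/-- `Prec S a a'` is the partial order `a ≼_S a'`, that is, `a' - a ∈ S`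
(the difference being taken in `ℤ^d`). -/
def Prec {d : ℕ} (S : AddSubmonoid (Fin d → ℕ)) (a a' : Fin d → ℕ) : Prop :=
  ∃ s ∈ S, a' = a + s

/-- The relation `Prec S a a'` says that the difference `a' - a` in `ℤ^d` lies in `S`. -/
theorem prec_iff_sub {d : ℕ} (S : AddSubmonoid (Fin d → ℕ)) (a a' : Fin d → ℕ) :
    Prec S a a' ↔ toInt a' - toInt a ∈ toInt '' (S : Set (Fin d → ℕ)) := by
  constructor
  · rintro ⟨s, hs, rfl⟩
    exact ⟨s, hs, by ext i; simp [toInt]⟩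
  · rintro ⟨s, hs, h⟩
    refine ⟨s, hs, ?_⟩
    ext i
    have := congrFun h i
    simp only [toInt, Pi.sub_apply] at this
    simp only [Pi.add_apply]
    omega

/-- The Apery set `Ap(S, B) = {a ∈ S | a - b ∉ S for all b ∈ B}`. -/
def Apery {d : ℕ} (S : AddSubmonoid (Fin d → ℕ)) (B : Finset (Fin d → ℕ)) :
    Set (Fin d → ℕ) :=
  {a | a ∈ S ∧ ∀ b ∈ B, ¬ Prec S b a}

/-- The set `X` has a maximal element with respect to `≼_S`. -/
def HasMaximal {d : ℕ} (S : AddSubmonoid (Fin d → ℕ)) (X : Set (Fin d → ℕ)) : Prop :=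
  ∃ m ∈ X, ∀ x ∈ X, Prec S m x → x = m

/-- The simplicial complex `T_b` of all `F ⊆ E` with `b - ∑_{a ∈ F} a ∈ S`. In Mathlib's convention
the empty face is not listed among the faces. Its vertices are the `a ∈ E` with `b - a ∈ S`. -/
def T {d : ℕ} (S : AddSubmonoid (Fin d → ℕ)) (E : Finset (Fin d → ℕ)) (hE : ∀ a ∈ E, a ∈ S)
    (b : Fin d → ℕ) : PreAbstractSimplicialComplex (Fin d → ℕ) where
  faces := {F | F.Nonempty ∧ F ⊆ E ∧ Prec S (∑ a ∈ F, a) b}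
  isRelLowerSet_faces := by
    rintro F ⟨hne, hFE, s, hs, hb⟩
    refine ⟨hne, fun G hGF hG => ⟨hG, hGF.trans hFE, (∑ a ∈ F \ G, a) + s, ?_, ?_⟩⟩
    · exact S.add_mem (S.sum_mem fun a ha => hE a (hFE (Finset.sdiff_subset ha))) hs
    · rw [hb, ← Finset.sum_sdiff hGF]
      abel

/-- The vertices of a simplicial complex. -/
def vertices {V : Type*} (K : PreAbstractSimplicialComplex V) : Set V := {v | {v} ∈ K.faces}

/-- The graph (1-skeleton) of a simplicial complex, on its vertices. -/
def skeletonGraph {V : Type*} [DecidableEq V] (K : PreAbstractSimplicialComplex V) :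
    SimpleGraph (vertices K) where
  Adj v w := v ≠ w ∧ ({v.1, w.1} : Finset V) ∈ K.faces
  symm := ⟨fun v w h => ⟨h.1.symm, by rw [Finset.pair_comm]; exact h.2⟩⟩
  loopless := ⟨fun _ h => h.1 rfl⟩

/-- A simplicial complex is connected when any two of its vertices are joined by a path of edges. -/
def IsConnected {V : Type*} [DecidableEq V] (K : PreAbstractSimplicialComplex V) : Prop :=
  (skeletonGraph K).Preconnected

/-- `v` is an isolated vertex: `v` is a vertex, and no face other than `{v}` contains it. -/
def IsIsolatedVertex {V : Type*} (K : PreAbstractSimplicialComplex V) (v : V) : Prop :=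
  {v} ∈ K.faces ∧ ∀ F ∈ K.faces, v ∈ F → F = {v}

/-- The monomial maximal ideal of the semigroup ring `k[S]`, generated by all monomials `t^a`
with `0 ≠ a ∈ S`. -/
def monomialIdeal (k : Type*) [Field k] {d : ℕ} (S : AddSubmonoid (Fin d → ℕ)) :
    Ideal (AddMonoidAlgebra k S) :=
  Ideal.span {f | ∃ a : S, a ≠ 0 ∧ f = AddMonoidAlgebra.single a 1}

/-- The depth of `k[S]`: the maximum length of a `k[S]`-regular sequence in the monomial
maximal ideal, as an element of `ℕ ∪ {∞}`. -/
def depth (k : Type*) [Field k] {d : ℕ} (S : AddSubmonoid (Fin d → ℕ)) : ℕ∞ :=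
  ⨆ (rs : List (AddMonoidAlgebra k S)) (_ : ∀ r ∈ rs, r ∈ monomialIdeal k S)
    (_ : RingTheory.Sequence.IsRegular (AddMonoidAlgebra k S) rs), (rs.length : ℕ∞)

/-- The elements of `E` lie in the semigroup generated by `A`. -/
theorem IsSimplicial.mem {d : ℕ} {A E : Finset (Fin d → ℕ)} (h : IsSimplicial A E) :
    ∀ a ∈ E, a ∈ semigroup A :=
  fun _ ha => AddSubmonoid.subset_closure (h.subset ha)

end SimplicialSemigroup

end

namespace SimplicialSemigroup

/-! The vertex `e` of `T_b` is isolated exactly when `b = e + m` with `m` in `Ap(S, E \ {e})`, and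
the three-element subsets of `E` are the sets `E \ {e}`. If `m` is maximal there, `e + m` leaves the
Apery set, so some `w ≠ e` in `E` satisfies `w ≼ e + m`: a second vertex beside the isolated `e`.
Conversely, a second vertex `w` forces every `m + s` in the Apery set to have `s ∈ Ap(S, E)`.
Simpliciality makes `Ap(S, E)` finite, so a maximal element exists above `m`. -/

theorem prec_trans_add {d : ℕ} {S : AddSubmonoid (Fin d → ℕ)} {a b s : Fin d → ℕ}
    (h : Prec S a b) (hs : s ∈ S) : Prec S a (b + s) := by
  obtain ⟨t, ht, rfl⟩ := h
  exact ⟨t + s, S.add_mem ht hs, by abel⟩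

theorem IsSimplicial.ne_zero {d : ℕ} {A E : Finset (Fin d → ℕ)} (h : IsSimplicial A E)
    {e : Fin d → ℕ} (he : e ∈ E) : e ≠ 0 := by
  rintro rfl
  refine h.linearIndep.ne_zero (i := 0) he ?_
  ext i
  simp [toRat]

/-- Finitely many non-negative rationals have a common denominator. -/
theorem exists_common_denominator {ι : Type*} (E : Finset ι) (q : ι → ℚ)
    (hq : ∀ e ∈ E, 0 ≤ q e) :
    ∃ N : ℕ, 0 < N ∧ ∃ n : ι → ℕ, ∀ e ∈ E, (n e : ℚ) = N * q e := by
  refine ⟨∏ e ∈ E, (q e).den, Finset.prod_pos fun e _ => (q e).den_pos, ?_⟩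
  have key : ∀ e ∈ E, ∃ m : ℕ, (m : ℚ) = ((∏ e ∈ E, (q e).den : ℕ) : ℚ) * q e := by
    intro e he
    obtain ⟨c, hc⟩ := Finset.dvd_prod_of_mem (fun e => (q e).den) he
    refine ⟨c * (q e).num.toNat, ?_⟩
    have hnum : (((q e).num.toNat : ℤ) : ℚ) = (q e).num := by
      rw [Int.toNat_of_nonneg (Rat.num_nonneg.mpr (hq e he))]
    rw [hc]
    push_cast at hnum ⊢
    rw [hnum, mul_comm ((q e).den : ℚ), mul_assoc, Rat.den_mul_eq_num]
  choose! n hn using key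
  exact ⟨n, hn⟩

/-- A positive multiple of each nonzero generator dominates some extremal generator. -/
theorem IsSimplicial.exists_prec_nsmul {d : ℕ} {A E : Finset (Fin d → ℕ)}
    (h : IsSimplicial A E) {a : Fin d → ℕ} (ha : a ∈ A) (ha0 : a ≠ 0) :
    ∃ N : ℕ, ∃ e ∈ E, Prec (semigroup A) e (N • a) := by
  classical
  have hmem : toRat a ∈ pos E := by
    rw [h.pos_eq]
    refine ⟨Pi.single a 1, fun b _ => ?_, ?_⟩
    · by_cases hb : b = a
      · subst hb; simp
      · simp [hb]
    · rw [Finset.sum_eq_single_of_mem a ha]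
      · simp
      · intro b _ hb
        simp [hb]
  obtain ⟨q, hq, hsum⟩ := hmem
  obtain ⟨N, hN, n, hn⟩ := exists_common_denominator E q hq
  have hNa : N • a = ∑ e ∈ E, n e • e := by
    ext i
    have hi := congrFun hsum i
    simp only [toRat, Finset.sum_apply, Pi.smul_apply, smul_eq_mul] at hi ⊢
    have : ((N * a i : ℕ) : ℚ) = ((∑ e ∈ E, n e * e i : ℕ) : ℚ) := by
      push_cast
      rw [hi, Finset.mul_sum]
      refine Finset.sum_congr rfl fun e he => ?_
      rw [hn e he, mul_assoc]
    exact_mod_cast this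
  have hne : ∑ e ∈ E, n e • e ≠ 0 := by
    rw [← hNa]
    exact smul_ne_zero hN.ne' ha0
  -- Some coefficient `n e` is positive, so one copy of `e` splits off from `N • a`.
  obtain ⟨e, he, hne⟩ := Finset.exists_ne_zero_of_sum_ne_zero hne
  obtain ⟨m, hm⟩ := Nat.exists_eq_succ_of_ne_zero (left_ne_zero_of_smul hne)
  refine ⟨N, e, he, m • e + ∑ f ∈ E.erase e, n f • f, ?_, ?_⟩
  · exact add_mem (nsmul_mem (h.mem e he) m)
      (sum_mem fun f hf => nsmul_mem (h.mem f (Finset.mem_of_mem_erase hf)) _)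
  · rw [hNa, ← Finset.add_sum_erase E _ he, hm, Nat.succ_eq_add_one, add_smul, one_smul]
    abel

/-- The Apery set with respect to all extremal generators is finite. -/
theorem IsSimplicial.finite_apery {d : ℕ} {A E : Finset (Fin d → ℕ)} (h : IsSimplicial A E) :
    (Apery (semigroup A) E).Finite := by
  classical
  have key : ∀ a ∈ A, ∃ N : ℕ, a ≠ 0 → ∃ e ∈ E, Prec (semigroup A) e (N • a) := by
    intro a ha
    by_cases ha0 : a = 0
    · exact ⟨0, fun h0 => absurd ha0 h0⟩
    · obtain ⟨N, hN⟩ := h.exists_prec_nsmul ha ha0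
      exact ⟨N, fun _ => hN⟩
  choose! N hN using key
  -- A coefficient `c a ≥ N a` with `a ≠ 0` would put an extremal generator below the element, so
  -- Apery elements lie in this box.
  refine (Set.finite_Iic (∑ a ∈ A, N a • a)).subset ?_
  rintro s ⟨hs, hsE⟩
  obtain ⟨c, -, rfl⟩ := AddSubmonoid.mem_closure_finset.mp hs
  rw [Set.mem_Iic]
  refine Finset.sum_le_sum fun a ha => ?_
  by_cases ha0 : a = 0
  · simp [ha0]
  by_contra hle
  have hlt : N a ≤ c a := by
    by_contra hlt
    exact hle (smul_le_smul_of_nonneg_right (not_le.mp hlt).le zero_le)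
  obtain ⟨e, he, hprec⟩ := hN a ha ha0
  refine hsE e he ?_
  obtain ⟨r, hr⟩ := Nat.exists_eq_add_of_le hlt
  have hA : ∀ b ∈ A, b ∈ semigroup A := fun b hb => AddSubmonoid.subset_closure hb
  rw [← Finset.add_sum_erase A _ ha, hr, add_smul, add_assoc]
  exact prec_trans_add hprec (add_mem (nsmul_mem (hA a ha) r)
    (sum_mem fun b hb => nsmul_mem (hA b (Finset.mem_of_mem_erase hb)) _))

/-- If finitely many elements of `X` lie above `m ∈ X`, then `X` has a maximal element. -/
theorem hasMaximal_of_finite {d : ℕ} {S : AddSubmonoid (Fin d → ℕ)} {X : Set (Fin d → ℕ)}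
    {m : Fin d → ℕ} (hm : m ∈ X) (hfin : {x ∈ X | Prec S m x}.Finite) : HasMaximal S X := by
  -- The coordinate sum strictly increases along `≼`, since a nonzero vector of `ℕ^d` has positive
  -- sum.
  obtain ⟨y, ⟨hyX, hmy⟩, hy⟩ := Set.exists_max_image _ (fun x : Fin d → ℕ => ∑ i, x i) hfin
    ⟨m, hm, 0, S.zero_mem, by simp⟩
  refine ⟨y, hyX, ?_⟩
  rintro _ hx ⟨s, hs, rfl⟩
  have hle := hy _ ⟨hx, prec_trans_add hmy hs⟩
  simp only [Pi.add_apply, Finset.sum_add_distrib, add_le_iff_nonpos_right,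
    nonpos_iff_eq_zero, Finset.sum_eq_zero_iff, Finset.mem_univ, true_implies] at hle
  ext i
  simp [hle i]

/-- An isolated vertex of a complex with a second vertex makes the complex disconnected. -/
theorem not_isConnected_of_isIsolatedVertex {V : Type*} [DecidableEq V]
    {K : PreAbstractSimplicialComplex V} {v w : V} (hv : IsIsolatedVertex K v)
    (hw : w ∈ vertices K) (hne : v ≠ w) : ¬ IsConnected K := by
  intro hK
  obtain ⟨p⟩ := hK ⟨v, hv.1⟩ ⟨w, hw⟩
  cases p with
  | nil => exact hne rfl
  | @cons _ u _ hadj _ =>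
    have heq := hv.2 _ hadj.2 (by simp)
    have hu : u.1 ∈ ({v} : Finset V) := heq ▸ by simp
    exact hadj.1 (Subtype.ext (Finset.mem_singleton.mp hu).symm)

/-- Preconnectedness holds trivially on at most one vertex. -/
theorem exists_ne_of_not_isConnected {V : Type*} [DecidableEq V]
    {K : PreAbstractSimplicialComplex V} (hK : ¬ IsConnected K) (v : V) :
    ∃ w ∈ vertices K, w ≠ v := by
  by_contra! hall
  refine hK fun x y => ?_
  rw [Subtype.ext ((hall x x.2).trans (hall y y.2).symm)]

/-- A vertex `e` of `T_b` is isolated exactly when `b - e` lies in the Apery set of the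
other extremal generators. -/
theorem isIsolatedVertex_T_iff {d : ℕ} {S : AddSubmonoid (Fin d → ℕ)}
    {E : Finset (Fin d → ℕ)} (hE : ∀ a ∈ E, a ∈ S) {b e : Fin d → ℕ} :
    IsIsolatedVertex (T S E hE b) e ↔ e ∈ E ∧ ∃ m ∈ Apery S (E.erase e), b = e + m := by
  constructor
  · rintro ⟨⟨-, heE, m, hm, hb⟩, hiso⟩
    rw [Finset.singleton_subset_iff] at heE
    rw [Finset.sum_singleton] at hb
    refine ⟨heE, m, ⟨hm, ?_⟩, hb⟩
    rintro f hf ⟨s, hs, rfl⟩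
    obtain ⟨hfe, hfE⟩ := Finset.mem_erase.mp hf
    have hpair : ({e, f} : Finset (Fin d → ℕ)) ∈ (T S E hE b).faces := by
      refine ⟨by simp, by simp [Finset.insert_subset_iff, heE, hfE], s, hs, ?_⟩
      rw [Finset.sum_pair hfe.symm, hb, add_assoc]
    have hf' : f ∈ ({e} : Finset (Fin d → ℕ)) := hiso _ hpair (by simp) ▸ by simp
    exact hfe (Finset.mem_singleton.mp hf')
  · rintro ⟨heE, m, ⟨hm, hmE⟩, rfl⟩
    refine ⟨⟨by simp, by simpa using heE, m, hm, by simp⟩, ?_⟩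
    rintro F ⟨-, hFE, s, hs, hb⟩ heF
    refine Finset.eq_singleton_iff_unique_mem.mpr ⟨heF, fun f hf => ?_⟩
    by_contra hfe
    -- Cancelling `e` from `∑ F ≼ e + m` leaves `f ≼ m`.
    have hfF : f ∈ F.erase e := Finset.mem_erase.mpr ⟨hfe, hf⟩
    refine hmE f (Finset.mem_erase.mpr ⟨hfe, hFE hf⟩)
      ⟨∑ a ∈ (F.erase e).erase f, a + s, add_mem (sum_mem fun a ha => ?_) hs, ?_⟩
    · exact hE a (hFE (Finset.mem_of_mem_erase (Finset.mem_of_mem_erase ha)))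
    · rw [← Finset.add_sum_erase F _ heF, ← Finset.add_sum_erase _ _ hfF] at hb
      refine add_left_cancel (a := e) (hb.trans ?_)
      abel

theorem mem_vertices_T_iff {d : ℕ} {S : AddSubmonoid (Fin d → ℕ)}
    {E : Finset (Fin d → ℕ)} (hE : ∀ a ∈ E, a ∈ S) {b e : Fin d → ℕ} :
    e ∈ vertices (T S E hE b) ↔ e ∈ E ∧ Prec S e b := by
  simp [vertices, T]

/-- If `m` lies in the Apery set of the extremal generators other than `e` and `T_{e + m}` has a
second vertex, then that Apery set has a maximal element: everything above `m` in it differs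
from `m` by an element of the finite set `Ap(S, E)`. -/
theorem IsSimplicial.hasMaximal_apery_erase {d : ℕ} {A E : Finset (Fin d → ℕ)}
    (h : IsSimplicial A E) {e w m : Fin d → ℕ} (hw : w ∈ E.erase e)
    (hm : m ∈ Apery (semigroup A) (E.erase e)) (hwb : Prec (semigroup A) w (e + m)) :
    HasMaximal (semigroup A) (Apery (semigroup A) (E.erase e)) := by
  refine hasMaximal_of_finite hm ((h.finite_apery.image (m + ·)).subset ?_)
  rintro _ ⟨⟨-, hxE⟩, s, hs, rfl⟩
  refine ⟨s, ⟨hs, ?_⟩, rfl⟩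
  rintro f hf hfs
  -- If `e ≼ s`, then `w ≼ e + m ≼ m + s`; if `f ≼ s` with `f ≠ e`, then `f ≼ m + s`. Both
  -- contradict `m + s` being in the Apery set.
  by_cases hfe : f = e
  · subst hfe
    obtain ⟨t, ht, rfl⟩ := hfs
    apply hxE w hw
    rw [← add_assoc, add_comm m]
    exact prec_trans_add hwb ht
  · apply hxE f (Finset.mem_erase.mpr ⟨hfe, hf⟩)
    rw [add_comm]
    exact prec_trans_add hfs hm.1

end SimplicialSemigroup

open SimplicialSemigroup in
theorem proposition6p7 {k : Type*} [Field k] {A E : Finset (Fin 4 → ℕ)}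
    (h : SimplicialSemigroup.IsSimplicial A E)
    (hdepth : SimplicialSemigroup.depth k (SimplicialSemigroup.semigroup A) = 3) :
    (∃ E' : Finset (Fin 4 → ℕ), E' ⊆ E ∧ E'.card = 3 ∧
      SimplicialSemigroup.HasMaximal (SimplicialSemigroup.semigroup A)
        (SimplicialSemigroup.Apery (SimplicialSemigroup.semigroup A) E')) ↔
    (∃ b ∈ SimplicialSemigroup.semigroup A,
      ¬ SimplicialSemigroup.IsConnected
        (SimplicialSemigroup.T (SimplicialSemigroup.semigroup A) E h.mem b) ∧
      ∃ v, SimplicialSemigroup.IsIsolatedVertex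
        (SimplicialSemigroup.T (SimplicialSemigroup.semigroup A) E h.mem b) v) := by
  constructor
  · rintro ⟨E', hE', hcard, m, hm, hmax⟩
    obtain ⟨e, he⟩ : ∃ e, E \ E' = {e} := by
      rw [← Finset.card_eq_one, Finset.card_sdiff_of_subset hE', h.card_eq, hcard]
    have heE : e ∈ E ∧ e ∉ E' := Finset.mem_sdiff.mp (he ▸ Finset.mem_singleton_self e)
    obtain rfl : E' = E.erase e := by
      rw [← Finset.sdiff_singleton_eq_erase, ← he, Finset.sdiff_sdiff_eq_self hE']
    have heS := h.mem e heE.1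
    -- Since `e ≠ 0`, `e + m` is strictly above the maximal `m`.
    have hnot : e + m ∉ Apery (semigroup A) (E.erase e) := fun hmem =>
      h.ne_zero heE.1 (add_eq_right.mp (hmax _ hmem ⟨e, heS, add_comm e m⟩))
    have hbS : e + m ∈ semigroup A := add_mem heS hm.1
    obtain ⟨w, hw, hwb⟩ : ∃ w ∈ E.erase e, Prec (semigroup A) w (e + m) := by
      by_contra! hall
      exact hnot ⟨hbS, hall⟩
    obtain ⟨hwe, hwE⟩ := Finset.mem_erase.mp hw
    have hiso := (isIsolatedVertex_T_iff h.mem).mpr ⟨heE.1, m, hm, rfl⟩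
    exact ⟨e + m, hbS, not_isConnected_of_isIsolatedVertex hiso
      ((mem_vertices_T_iff h.mem).mpr ⟨hwE, hwb⟩) hwe.symm, e, hiso⟩
  · rintro ⟨b, -, hconn, e, hiso⟩
    obtain ⟨w, hw, hwe⟩ := exists_ne_of_not_isConnected hconn e
    obtain ⟨heE, m, hm, rfl⟩ := (isIsolatedVertex_T_iff h.mem).mp hiso
    obtain ⟨hwE, hwb⟩ := (mem_vertices_T_iff h.mem).mp hw
    exact ⟨E.erase e, Finset.erase_subset _ _, by rw [Finset.card_erase_of_mem heE, h.card_eq],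
      h.hasMaximal_apery_erase (Finset.mem_erase.mpr ⟨hwe, hwE⟩) hm hwb⟩
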